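/- A group $G$ is called a \emph{$J$-group} if there exist an element $k\in G$ and a function $f\colon G\to G$ such that $f(xk)=xf(x)$ for all $x\in G$. Let $c\ge 0$ be an integer and let $G$ be a finite nilpotent group of odd order whose nilpotency class is at most $c$. If every prime $p$ dividing $|G|$ satisfies $p^2>2c-1$, then $G$ is a $J$-group. -/

import Mathlib

/-- A group `G` is a *J-group* if there are an element `k : G` and a function `f : G → G`
such that `f (x * k) = x * f x` for all `x : G`. -/
def IsJGroup (G : Type*) [Group G] : Prop :=
  ∃ (k : G) (f : G → G), ∀ x : G, f (x * k) = x * f x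

open Subgroup
open scoped commutatorElement

/-! Iterating `f (x * k) = x * f x` around a coset of `⟨k⟩` shows that `k` works once `descProd x k`
is trivial at the order of `k`, for every `x` (`isJGroup_of_descProd`). Sylow decomposition reduces
to a `p`-group of exponent `p ^ e`, and `k` of order `p ^ e` is chosen so that `⟨x, k⟩` has derived
subgroup of exponent dividing `p ^ (e - 1)`. For a filtration in which `k` has weight two, `descProd
x k` is a polynomial sequence, so its value at `n` is a product of powers `a_j ^ C(n, j)` with `a_j
∈ F j` (`apply_eq_one`). At `n = p ^ e` every factor dies: by the exponent for `j ≤ 2`, by that of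
the derived subgroup for `3 ≤ j < p ^ 2`, and by nilpotency for `j ≥ p ^ 2 ≥ 2 * c`. -/

/-- A decreasing family of subgroups with `⁅F i, F j⁆ ≤ F (i + j)`. -/
structure CommFiltration (S : Type*) [Group S] where
  /-- the subgroup of a given index -/
  F : ℕ → Subgroup S
  succ_le : ∀ i, F (i + 1) ≤ F i
  comm : ∀ i j a b, a ∈ F i → b ∈ F j → ⁅a, b⁆ ∈ F (i + j)

/-! ### Filtrations and their derived filtrations -/

namespace CommFiltration

variable {S : Type*} [Group S]

theorem antitone (Φ : CommFiltration S) : Antitone Φ.F := antitone_nat_of_succ_le Φ.succ_le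

theorem conj_mem (Φ : CommFiltration S) {i : ℕ} {x q : S} (hx : x ∈ Φ.F 0) (hq : q ∈ Φ.F i) :
    x * q * x⁻¹ ∈ Φ.F i := by
  have h := Φ.comm 0 i x q hx hq
  rw [zero_add] at h
  have := mul_mem h hq
  rwa [commutatorElement_def, inv_mul_cancel_right] at this

/-- The elements `g` of `F i` with `τ g * g⁻¹ ∈ F (i + 1)` form a filtration again. -/
def derived (Φ : CommFiltration S) (τ : S →* S) : CommFiltration S where
  F i :=
    { carrier := {g | g ∈ Φ.F i ∧ τ g * g⁻¹ ∈ Φ.F (i + 1)}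
      one_mem' := by simp
      mul_mem' := by
        rintro f g ⟨hf, hf'⟩ ⟨hg, hg'⟩
        refine ⟨mul_mem hf hg, ?_⟩
        have h := mul_mem hf' (Φ.conj_mem (Φ.antitone (Nat.zero_le i) hf) hg')
        convert h using 1
        rw [map_mul]
        group
      inv_mem' := by
        rintro g ⟨hg, hg'⟩
        refine ⟨inv_mem hg, ?_⟩
        have h := Φ.conj_mem (inv_mem (Φ.antitone (Nat.zero_le i) hg)) (inv_mem hg')
        convert h using 1
        rw [map_inv]
        group }
  succ_le i := fun g hg => ⟨Φ.succ_le i hg.1, Φ.succ_le (i + 1) hg.2⟩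
  comm i j f g := by
    rintro ⟨hf, hf'⟩ ⟨hg, hg'⟩
    refine ⟨Φ.comm i j f g hf hg, ?_⟩
    obtain ⟨a, ha⟩ : ∃ a, a = τ f * f⁻¹ := ⟨_, rfl⟩
    obtain ⟨b, hb⟩ : ∃ b, b = τ g * g⁻¹ := ⟨_, rfl⟩
    rw [← ha] at hf'
    rw [← hb] at hg'
    have h0 {l : ℕ} {y : S} (hy : y ∈ Φ.F l) : y ∈ Φ.F 0 := Φ.antitone (Nat.zero_le l) hy
    have hc := Φ.comm i j f g hf hg
    have q1 : ⁅f, b⁆ ∈ Φ.F (i + j + 1) := Φ.comm i (j + 1) f b hf hg'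
    have q2 : ⁅a, b⁆ ∈ Φ.F (i + j + 1) :=
      Φ.antitone (by omega) (Φ.comm (i + 1) (j + 1) a b hf' hg')
    have q3 : ⁅a, g⁆ ∈ Φ.F (i + j + 1) := by
      have := Φ.comm (i + 1) j a g hf' hg
      rwa [show i + 1 + j = i + j + 1 by ring] at this
    have q4 : ⁅a * b, ⁅f, g⁆⁆ ∈ Φ.F (i + j + 1) := by
      have := Φ.comm 1 (i + j) (a * b) _
        (mul_mem (Φ.antitone (by omega) hf') (Φ.antitone (by omega) hg')) hc
      rwa [add_comm 1] at this
    -- With `τ f = a * f` and `τ g = b * g`, this product is the expansion of `⁅a * f, b * g⁆ * ⁅f,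
    -- g⁆⁻¹`.
    have h := mul_mem (mul_mem (Φ.conj_mem (h0 hf') q1) q4)
      (Φ.conj_mem (h0 hc) (mul_mem q2 (Φ.conj_mem (h0 hg') q3)))
    convert h using 1
    rw [map_commutatorElement, show τ f = a * f by rw [ha]; group,
      show τ g = b * g by rw [hb]; group]
    simp only [commutatorElement_def]
    group

end CommFiltration

/-! ### Polynomial sequences and their Taylor expansion -/

section Poly

variable {G : Type*} [Group G]

/-- The shift on sequences. -/
def seqShift (G : Type*) [Group G] : (ℕ → G) →* (ℕ → G) where
  toFun g n := g (n + 1)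
  map_one' := rfl
  map_mul' _ _ := rfl

/-- The discrete derivative of a sequence. -/
def seqDiff (g : ℕ → G) : ℕ → G := fun n => g (n + 1) * (g n)⁻¹

/-- The pointwise filtration on sequences. -/
def CommFiltration.seq (Φ : CommFiltration G) : CommFiltration (ℕ → G) where
  F i := Subgroup.pi Set.univ fun _ => Φ.F i
  succ_le i _ hg n _ := Φ.succ_le i (hg n trivial)
  comm i j a b ha hb n _ := Φ.comm i j (a n) (b n) (ha n trivial) (hb n trivial)

/-- Sequences whose first `d` derivatives obey the filtration. -/
def CommFiltration.poly (Φ : CommFiltration G) : ℕ → CommFiltration (ℕ → G)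
  | 0 => Φ.seq
  | d + 1 => (Φ.poly d).derived (seqShift G)

variable (Φ : CommFiltration G)

theorem CommFiltration.mem_poly_succ {d i : ℕ} {g : ℕ → G} :
    g ∈ (Φ.poly (d + 1)).F i ↔ g ∈ (Φ.poly d).F i ∧ seqDiff g ∈ (Φ.poly d).F (i + 1) :=
  Iff.rfl

theorem CommFiltration.mem_poly_zero {i : ℕ} {g : ℕ → G} :
    g ∈ (Φ.poly 0).F i ↔ ∀ n, g n ∈ Φ.F i :=
  ⟨fun h n => h n trivial, fun h n _ => h n⟩

/-- By Pascal's rule, differentiating lowers `j` by one while `i` rises by one. -/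
theorem CommFiltration.pow_choose_mem_poly (d : ℕ) : ∀ (i j : ℕ) {a : G}, a ∈ Φ.F (i + j) →
    (fun n : ℕ => a ^ n.choose j) ∈ (Φ.poly d).F i := by
  induction d with
  | zero =>
    intro i j a ha
    exact Φ.mem_poly_zero.2 fun n => pow_mem (Φ.antitone (by omega) ha) _
  | succ d ih =>
    intro i j a ha
    refine Φ.mem_poly_succ.2 ⟨ih i j ha, ?_⟩
    cases j with
    | zero =>
      convert one_mem ((Φ.poly d).F (i + 1)) using 1
      ext n
      simp [seqDiff]
    | succ j =>
      convert ih (i + 1) j (a := a) (by rwa [show i + 1 + j = i + (j + 1) by ring]) using 1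
      ext n
      simp [seqDiff, Nat.choose_succ_succ, pow_add]

/-- The `j`-th derivative of `v` at `0` is `v j` when the earlier values are trivial, and each
derivative gains one step of the filtration. -/
theorem CommFiltration.apply_mem_of_vanish (j : ℕ) : ∀ (i : ℕ) {v : ℕ → G},
    v ∈ (Φ.poly j).F i → (∀ m < j, v m = 1) → v j ∈ Φ.F (i + j) := by
  induction j with
  | zero => exact fun i v hv _ => Φ.mem_poly_zero.1 hv 0
  | succ j ih =>
    intro i v hv h
    have := ih (i + 1) (Φ.mem_poly_succ.1 hv).2 fun m hm => by
      simp [seqDiff, h m (by omega), h (m + 1) (by omega)]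
    rw [seqDiff, h j (by omega), inv_one, mul_one] at this
    rwa [show i + (j + 1) = i + 1 + j by ring]

/-- A polynomial sequence starting at `1` equals `1` at `n` if the powers `C(n, j)` of the elements
of `F j` are trivial. -/
theorem CommFiltration.apply_eq_one {u : ℕ → G} (hu : ∀ d, u ∈ (Φ.poly d).F 0) (h0 : u 0 = 1)
    {n : ℕ} (hn : ∀ j, 1 ≤ j → ∀ a ∈ Φ.F j, a ^ n.choose j = 1) : u n = 1 := by
  have key : ∀ j, 1 ≤ j → ∃ v : ℕ → G, (∀ d, v ∈ (Φ.poly d).F 0) ∧ (∀ m < j, v m = 1) ∧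
      v n = u n := by
    intro j hj
    induction j, hj using Nat.le_induction with
    | base => exact ⟨u, hu, fun m hm => by rwa [Nat.lt_one_iff.1 hm], rfl⟩
    | succ j hj ih =>
      obtain ⟨v, hv, hv0, hvn⟩ := ih
      have ha := Φ.apply_mem_of_vanish j 0 (hv j) hv0
      rw [zero_add] at ha
      -- Divide out the `j`-th Taylor factor; by `hn` this leaves the value at `n` unchanged.
      refine ⟨v * fun m => (v j)⁻¹ ^ m.choose j, fun d => mul_mem (hv d)
        (Φ.pow_choose_mem_poly d 0 j (by simpa using ha)), fun m hm => ?_, ?_⟩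
      · rcases Nat.lt_succ_iff_lt_or_eq.1 hm with hm | rfl
        · simp [hv0 m hm, Nat.choose_eq_zero_of_lt hm]
        · simp
      · simp [hvn, hn j hj _ ha]
  obtain ⟨v, -, hv, hvn⟩ := key (n + 1) (by omega)
  rw [← hvn, hv n (by omega)]

end Poly

/-! ### Lower central series and the weight filtration -/

section LowerCentral

variable {G : Type*} [Group G]

local notation "γ" => Subgroup.lowerCentralSeries (⊤ : Subgroup G)

/-- The three subgroups lemma modulo the target; the `+ 1` comes from indexing the series from zero.
-/
theorem commutator_lowerCentralSeries_le (i j : ℕ) : ⁅γ i, γ j⁆ ≤ γ (i + j + 1) := by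
  induction j generalizing i with
  | zero => exact le_of_eq rfl
  | succ j ih =>
    have hN : (γ (i + (j + 1) + 1)).Normal := inferInstance
    set N := γ (i + (j + 1) + 1) with hNdef
    have e (H K L : Subgroup G) : ⁅⁅H, K⁆, L⁆ ≤ N ↔ ⁅⁅H.map (QuotientGroup.mk' N),
        K.map (QuotientGroup.mk' N)⁆, L.map (QuotientGroup.mk' N)⁆ = ⊥ := by
      rw [← map_commutator, ← map_commutator, Subgroup.map_eq_bot_iff, QuotientGroup.ker_mk']
    rw [commutator_comm, Subgroup.lowerCentralSeries_succ, e]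
    refine commutator_commutator_eq_bot_of_rotate ((e _ _ _).1 ?_) ((e _ _ _).1 ?_)
    · rw [commutator_comm ⊤, ← Subgroup.lowerCentralSeries_succ]
      refine (ih (i + 1)).trans (le_of_eq ?_)
      rw [hNdef]; congr 1; ring
    · refine (commutator_mono (ih i) le_rfl).trans (le_of_eq ?_)
      rw [← Subgroup.lowerCentralSeries_succ, hNdef]; rfl

/-- Modulo `γ 2`, `γ 1` is central and `zpowers k` is abelian. -/
theorem commutator_zpowers_sup_le (k : G) :
    ⁅zpowers k ⊔ γ 1, zpowers k ⊔ γ 1⁆ ≤ γ 2 := by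
  rw [← QuotientGroup.ker_mk' (γ 2), ← Subgroup.map_eq_bot_iff, map_commutator, Subgroup.map_sup,
    commutator_eq_bot_iff_le_centralizer, MonoidHom.map_zpowers]
  have hc : (γ 1).map (QuotientGroup.mk' (γ 2)) ≤ center _ := by
    rw [← centralizer_univ, ← coe_top, ← commutator_eq_bot_iff_le_centralizer,
      ← map_top_of_surjective _ (QuotientGroup.mk'_surjective (γ 2)), ← map_commutator,
      Subgroup.map_eq_bot_iff, QuotientGroup.ker_mk']
    exact le_of_eq rfl
  refine sup_le ?_ (hc.trans (center_le_centralizer _))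
  rw [le_centralizer_iff]
  refine sup_le ?_ (hc.trans (center_le_centralizer _))
  exact le_centralizer _

/-- The filtration giving `k` weight two and all other elements weight one. -/
def weightFiltration (k : G) : CommFiltration G where
  -- A nontrivial commutator of `r` entries cannot have all entries `k`, so its weight is at most `2
  -- * r - 1`; weight `j` thus forces `r ≥ j / 2 + 1`, which is `γ (j / 2)` in zero-based indexing.
  F j := if j ≤ 1 then ⊤ else if j = 2 then zpowers k ⊔ γ 1 else γ (j / 2)
  succ_le i := by
    split_ifs <;> first | omega | exact le_top | skip
    · subst_vars; exact le_sup_right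
    · exact Subgroup.lowerCentralSeries_antitone _ (by omega)
  comm i j a b ha hb := by
    have top (j : ℕ) (x : G) (y : G) (hy : y ∈ γ j) : ⁅x, y⁆ ∈ γ (j + 1) := by
      have := commutator_lowerCentralSeries_le 0 j
        (commutator_mem_commutator (mem_top x : x ∈ γ 0) hy)
      rwa [zero_add] at this
    have top' (j : ℕ) (x : G) (y : G) (hx : x ∈ γ j) : ⁅x, y⁆ ∈ γ (j + 1) :=
      commutator_mem_commutator hx (mem_top y)
    have h1 (x y : G) : ⁅x, y⁆ ∈ γ 1 := top 0 x y trivial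
    have nor : (zpowers k ⊔ γ 1).Normal := by
      refine ⟨fun n hn g => ?_⟩
      have := mul_mem (mem_sup_right (h1 g n) : _ ∈ zpowers k ⊔ γ 1) hn
      rwa [commutatorElement_def, inv_mul_cancel_right] at this
    have anti {m n : ℕ} (h : m ≤ n) {x : G} (hx : x ∈ γ n) : x ∈ γ m :=
      Subgroup.lowerCentralSeries_antitone _ h hx
    by_cases hi : i ≤ 1
    · by_cases hj : j ≤ 1
      · rcases Nat.lt_or_ge (i + j) 2 with h | h
        · rw [if_pos (by omega)]; trivial
        · rw [if_neg (by omega), if_pos (by omega)]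
          exact mem_sup_right (h1 a b)
      · rw [if_neg hj] at hb
        rw [if_neg (by omega)]
        by_cases hj2 : j = 2
        · rw [if_pos hj2] at hb
          split_ifs
          · exact mem_sup_right (h1 a b)
          · exact anti (by omega) (h1 a b)
        · rw [if_neg hj2] at hb
          rw [if_neg (by omega)]
          exact anti (by omega) (top _ a b hb)
    · rw [if_neg hi] at ha
      rw [if_neg (by omega)]
      by_cases hij : i + j = 2
      · rw [if_pos hij]
        exact mem_sup_right (h1 a b)
      rw [if_neg hij]
      by_cases hi2 : i = 2
      · rw [if_pos hi2] at ha
        by_cases hj : j ≤ 1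
        · exact anti (by omega) (h1 a b)
        rw [if_neg hj] at hb
        by_cases hj2 : j = 2
        · rw [if_pos hj2] at hb
          exact anti (by omega) (commutator_zpowers_sup_le k (commutator_mem_commutator ha hb))
        · rw [if_neg hj2] at hb
          exact anti (by omega) (top _ a b hb)
      · rw [if_neg hi2] at ha
        by_cases hj : j ≤ 1
        · exact anti (by omega) (top' _ a b ha)
        rw [if_neg hj] at hb
        by_cases hj2 : j = 2
        · exact anti (by omega) (top' _ a b ha)
        · rw [if_neg hj2] at hb
          exact anti (n := i / 2 + j / 2 + 1) (by omega)
            (commutator_lowerCentralSeries_le _ _ (commutator_mem_commutator ha hb))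

end LowerCentral

/-! ### Binomial coefficients of prime powers -/

theorem pow_pred_dvd_choose {p : ℕ} (hp : p.Prime) (e j : ℕ) (hj : 1 ≤ j) (hj2 : j < p ^ 2) :
    p ^ (e - 1) ∣ (p ^ e).choose j := by
  obtain ⟨i, rfl⟩ : ∃ i, j = i + 1 := ⟨j - 1, by omega⟩
  obtain ⟨n, hn⟩ : ∃ n, p ^ e = n + 1 := ⟨p ^ e - 1, by have := pow_pos hp.pos e; omega⟩
  -- Since `j < p ^ 2`, the factor `j` absorbs at most one `p`.
  have h : p ^ e ∣ (p ^ e).choose (i + 1) * (i + 1) := by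
    rw [hn, ← Nat.add_one_mul_choose_eq]
    exact dvd_mul_right _ _
  rcases Nat.eq_zero_or_pos e with rfl | he
  · simp
  by_cases hd : p ∣ i + 1
  · obtain ⟨l, hl⟩ := hd
    have hlp : ¬ p ∣ l := by
      rintro ⟨r, rfl⟩
      have : 0 < r := by
        rcases Nat.eq_zero_or_pos r with rfl | h
        · simp at hl
        · exact h
      nlinarith [Nat.mul_le_mul_left (p * p) this]
    rw [hl] at h ⊢
    have h' : p ^ (e - 1) ∣ (p ^ e).choose (p * l) * l := by
      refine Nat.dvd_of_mul_dvd_mul_left hp.pos ?_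
      rw [← pow_succ', Nat.sub_add_cancel he]
      convert h using 1; ring
    exact (Nat.Coprime.pow_left _ ((hp.coprime_iff_not_dvd).2 hlp)).dvd_of_dvd_mul_right h'
  · exact (pow_dvd_pow p (by omega)).trans
      ((Nat.Coprime.pow_left _ ((hp.coprime_iff_not_dvd).2 hd)).dvd_of_dvd_mul_right h)

theorem pow_dvd_choose_two {p : ℕ} (hp2 : Odd p) (e : ℕ) : p ^ e ∣ (p ^ e).choose 2 := by
  obtain ⟨m, hm⟩ := hp2.pow (n := e)
  rw [Nat.choose_two_right, hm, Nat.add_sub_cancel, mul_left_comm, Nat.mul_div_cancel_left _ two_pos]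
  exact dvd_mul_right _ _

/-! ### The descending products -/

/-- The sequence `1, x, (x * k) * x, (x * k ^ 2) * (x * k) * x, …`. -/
def descProd {G : Type*} [Group G] (x k : G) : ℕ → G
  | 0 => 1
  | n + 1 => x * k ^ n * descProd x k n

/-- The derivative `x * k ^ n` must lie in level one, so the linear exponent of `k` calls for `k ∈ F
2`. -/
theorem descProd_mem_poly {G : Type*} [Group G] (x k : G) (d : ℕ) :
    descProd x k ∈ ((weightFiltration k).poly d).F 0 := by
  have hd : seqDiff (descProd x k) =
      (fun n : ℕ => x ^ n.choose 0) * fun n : ℕ => k ^ n.choose 1 := by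
    ext n
    simp [seqDiff, descProd]
  induction d with
  | zero =>
    refine (weightFiltration k).mem_poly_zero.2 fun n => ?_
    simp [weightFiltration]
  | succ d ih =>
    refine (weightFiltration k).mem_poly_succ.2 ⟨ih, ?_⟩
    rw [hd]
    refine mul_mem ((weightFiltration k).pow_choose_mem_poly d _ _ ?_)
      ((weightFiltration k).pow_choose_mem_poly d _ _ ?_)
    · simp [weightFiltration]
    · exact mem_sup_left (mem_zpowers k)

theorem descProd_eq_one {G : Type*} [Group G] {p : ℕ} (hp : p.Prime) (hp2 : Odd p) {e c : ℕ}
    (hcp : 2 * c ≤ p ^ 2) (x k : G) (hc : (⊤ : Subgroup G).lowerCentralSeries c = ⊥)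
    (hexp : ∀ g : G, g ^ p ^ e = 1)
    (hcomm : ∀ g ∈ (⊤ : Subgroup G).lowerCentralSeries 1, g ^ p ^ (e - 1) = 1) :
    descProd x k (p ^ e) = 1 := by
  refine (weightFiltration k).apply_eq_one (descProd_mem_poly x k) rfl fun j hj a ha => ?_
  have aux {r s : ℕ} (h : r ∣ s) (hr : a ^ r = 1) : a ^ s = 1 := by
    obtain ⟨t, rfl⟩ := h
    rw [pow_mul, hr, one_pow]
  have hp3 : 4 < p ^ 2 := by
    have h2 := hp.two_le
    have h3 : p ≠ 2 := by rintro rfl; exact absurd hp2 (by decide)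
    have h4 : 3 ≤ p := by omega
    nlinarith
  rcases Nat.lt_or_ge j 3 with h3 | h3
  · obtain rfl | rfl : j = 1 ∨ j = 2 := by omega
    · rw [Nat.choose_one_right]; exact hexp a
    · exact aux (pow_dvd_choose_two hp2 e) (hexp a)
  · have ha' : a ∈ (⊤ : Subgroup G).lowerCentralSeries (j / 2) := by
      have := ha
      simp only [weightFiltration] at this
      rwa [if_neg (by omega), if_neg (by omega)] at this
    rcases Nat.lt_or_ge j (p ^ 2) with hj2 | hj2
    · exact aux (pow_pred_dvd_choose hp e j hj hj2)
        (hcomm a (Subgroup.lowerCentralSeries_antitone _ (by omega) ha'))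
    · have : a ∈ (⊤ : Subgroup G).lowerCentralSeries c :=
        Subgroup.lowerCentralSeries_antitone _ (by omega) ha'
      rw [hc, mem_bot] at this
      rw [this, one_pow]

theorem map_descProd {G H : Type*} [Group G] [Group H] (f : G →* H) (x k : G) (n : ℕ) :
    f (descProd x k n) = descProd (f x) (f k) n := by
  induction n with
  | zero => exact map_one f
  | succ n ih => simp [descProd, ih]

theorem isJGroup_of_descProd {G : Type*} [Group G] (k : G) (hk : 0 < orderOf k)
    (h : ∀ x : G, descProd x k (orderOf k) = 1) : IsJGroup G := by
  have per (x : G) (n : ℕ) : descProd x k (n + orderOf k) = descProd x k n := by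
    induction n with
    | zero => rw [zero_add, h]; rfl
    | succ n ih =>
      rw [show n + 1 + orderOf k = n + orderOf k + 1 by ring]
      simp [descProd, ih, pow_add, pow_orderOf_eq_one]
  -- Makes the definition of `f` below independent of the exponent chosen in `x = r * k ^ n`.
  have per' (x : G) {m n : ℕ} (hmn : k ^ m = k ^ n) : descProd x k m = descProd x k n := by
    have hp : Function.Periodic (descProd x k) (orderOf k) := per x
    rw [← hp.map_mod_nat m, ← hp.map_mod_nat n, pow_eq_pow_iff_modEq.1 hmn]
  have rep (x : G) : ∃ n : ℕ, x = (QuotientGroup.mk x : G ⧸ zpowers k).out * k ^ n := by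
    obtain ⟨y, hy⟩ := QuotientGroup.mk_out_eq_mul (zpowers k) x
    obtain ⟨n, hn⟩ := (isOfFinOrder_iff_pow_eq_one.2
      ⟨_, hk, pow_orderOf_eq_one k⟩).mem_powers_iff_mem_zpowers.2 (inv_mem y.2)
    refine ⟨n, ?_⟩
    simp only at hn
    rw [hn, hy, mul_inv_cancel_right]
  choose i hi using rep
  refine ⟨k, fun x => descProd (QuotientGroup.mk x : G ⧸ zpowers k).out k (i x), fun x => ?_⟩
  have hq : (QuotientGroup.mk (x * k) : G ⧸ zpowers k) = QuotientGroup.mk x :=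
    QuotientGroup.mk_mul_of_mem x (mem_zpowers k)
  have hik : k ^ i (x * k) = k ^ (i x + 1) := by
    have h1 := hi (x * k)
    rw [hq] at h1
    nth_rw 1 [hi x] at h1
    rw [mul_assoc, ← pow_succ] at h1
    exact (mul_left_cancel h1).symm
  beta_reduce
  rw [hq, per' _ hik, descProd, ← hi x]

/-! ### The case of `p`-groups and the conclusion -/

theorem IsPGroup.isJGroup {G : Type*} [Group G] [Finite G] {p : ℕ} (hp : p.Prime) (hp2 : Odd p)
    (hG : IsPGroup p G) {c : ℕ} (hclass : Group.nilpotencyClass G ≤ c) (hcp : 2 * c ≤ p ^ 2) :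
    IsJGroup G := by
  have := Fact.mk hp
  have := hG.isNilpotent
  obtain ⟨e, he⟩ := isPGroup_iff_exponent_eq_pow.1 hG
  have hexp (g : G) : g ^ p ^ e = 1 := he ▸ Monoid.pow_exponent_eq_one g
  have hbot : (⊤ : Subgroup G).lowerCentralSeries c = ⊥ :=
    Subgroup.lowerCentralSeries_eq_bot_iff_nilpotencyClass_le.2 hclass
  obtain ⟨k, hk, hkN⟩ : ∃ k : G, orderOf k = p ^ e ∧ ∃ N : Subgroup G, N.Normal ∧
      (∀ g ∈ N, g ^ p ^ (e - 1) = 1) ∧ ∀ y, ⁅k, y⁆ ∈ N := by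
    rcases Nat.eq_zero_or_pos e with rfl | hpos
    · refine ⟨1, by simp, ⊤, inferInstance, fun g _ => by simpa using hexp g, fun y => mem_top _⟩
    classical
    -- `N` is the first term of the lower central series killed by `p ^ (e - 1)`, and `k` is an
    -- element of the preceding term not so killed.
    have hex : ∃ m, ∀ g ∈ (⊤ : Subgroup G).lowerCentralSeries m, g ^ p ^ (e - 1) = 1 :=
      ⟨c, fun g hg => by rw [hbot, mem_bot] at hg; rw [hg, one_pow]⟩
    obtain ⟨m, hm⟩ : ∃ m, Nat.find hex = m + 1 := by
      refine Nat.exists_eq_succ_of_ne_zero fun h0 => ?_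
      have h1 := Nat.find_spec hex
      rw [h0] at h1
      have h2 : p ^ e ∣ p ^ (e - 1) := by
        rw [← he]
        exact Monoid.exponent_dvd_of_forall_pow_eq_one fun g => h1 g (mem_top g)
      have := (Nat.pow_dvd_pow_iff_le_right hp.one_lt).1 h2
      omega
    have h1 := Nat.find_spec hex
    have h2 := Nat.find_min hex (m := m) (by omega)
    rw [hm] at h1
    push Not at h2
    obtain ⟨k, hk, hk1⟩ := h2
    refine ⟨k, ?_, _, inferInstance, h1, fun y => commutator_mem_commutator hk (mem_top y)⟩
    obtain ⟨e', rfl⟩ : ∃ e', e = e' + 1 := ⟨e - 1, by omega⟩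
    exact orderOf_eq_prime_pow hk1 (hexp k)
  obtain ⟨N, hN, hNexp, hkN⟩ := hkN
  refine isJGroup_of_descProd k (orderOf_pos k) fun x => ?_
  rw [hk]
  set H := closure ({x, k} : Set G) with hH
  have hxH : x ∈ H := subset_closure (by simp)
  have hkH : k ∈ H := subset_closure (by simp)
  -- `k` is central modulo `N`, so the images of the generators `x` and `k` commute.
  have hHN : ⁅H, H⁆ ≤ N := by
    rw [← QuotientGroup.ker_mk' N, ← Subgroup.map_eq_bot_iff, map_commutator,
      commutator_eq_bot_iff_le_centralizer, hH, MonoidHom.map_closure, closure_le]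
    have hkc (y : G) : (k : G ⧸ N) * y = y * k := by
      rw [← commutatorElement_eq_one_iff_mul_comm]
      exact (QuotientGroup.eq_one_iff _).2 (hkN y)
    intro a ha
    refine mem_centralizer_iff.2 fun b hb => ?_
    refine mem_centralizer_singleton_iff.1 ((closure_le _).2 (fun b hb => ?_) hb)
    rw [SetLike.mem_coe, mem_centralizer_singleton_iff]
    rw [Set.image_pair] at ha hb
    rcases ha with rfl | rfl <;> rcases hb with rfl | rfl
    · rfl
    · exact hkc x
    · exact (hkc x).symm
    · rfl
  have key := descProd_eq_one hp hp2 (e := e) hcp (⟨x, hxH⟩ : H) ⟨k, hkH⟩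
    (Subgroup.lowerCentralSeries_eq_bot_iff_nilpotencyClass_le.2 ((nilpotencyClass_le H).trans hclass))
    (fun g => Subtype.ext (hexp g)) fun g hg => Subtype.ext (hNexp g (hHN ?_))
  · have := congrArg H.subtype key
    rwa [map_descProd, map_one] at this
  · have := mem_map_of_mem H.subtype hg
    rw [Subgroup.lowerCentralSeries_succ, Subgroup.lowerCentralSeries_zero, map_commutator] at this
    simpa [← MonoidHom.range_eq_map] using this

theorem IsJGroup.pi {ι : Type*} {G : ι → Type*} [∀ i, Group (G i)] (h : ∀ i, IsJGroup (G i)) :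
    IsJGroup (∀ i, G i) := by
  choose k f hf using h
  exact ⟨k, fun x i => f i (x i), fun x => funext fun i => hf i (x i)⟩

theorem IsJGroup.of_mulEquiv {G H : Type*} [Group G] [Group H] (e : G ≃* H) (h : IsJGroup G) :
    IsJGroup H := by
  obtain ⟨k, f, hf⟩ := h
  refine ⟨e k, fun x => e (f (e.symm x)), fun x => ?_⟩
  simp [hf]

theorem mainTheorem6 (G : Type*) [Group G] [Finite G] [Group.IsNilpotent G] (c : ℕ)
    (hodd : Odd (Nat.card G))
    (hclass : Group.nilpotencyClass G ≤ c)
    (hp : ∀ p : ℕ, p.Prime → p ∣ Nat.card G → 2 * (c : ℤ) - 1 < (p : ℤ) ^ 2) :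
    IsJGroup G := by
  obtain ⟨e⟩ := (Group.isNilpotent_of_finite_tfae (G := G)).out 0 4 |>.1 ‹_›
  refine IsJGroup.of_mulEquiv e (IsJGroup.pi fun p => IsJGroup.pi fun P => ?_)
  have hpp := Nat.prime_of_mem_primeFactors p.2
  have hdvd := Nat.dvd_of_mem_primeFactors p.2
  refine P.2.isJGroup hpp (hodd.of_dvd_nat hdvd) ((nilpotencyClass_le _).trans hclass) ?_
  have := hp p hpp hdvd
  zify
  omega
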